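/- **Setting.** For $\sigma>0$ let $L_2^\sigma(0,1)$ be $L_2(0,1)$ (real-valued functions) with the inner product $\langle x,y\rangle_\sigma=\int_0^1 e^{-2\sigma t}x(t)y(t)\,dt$ and norm $\|\cdot\|_\sigma$, and let $H_1^\sigma(0,1)$ be the space of absolutely continuous $x$ with $x'\in L_2(0,1)$, with norm $\|x\|_{1,\sigma}=\tfrac12(\|x\|_\sigma^2+\|x'\|_\sigma^2)^{1/2}$. Let $[F(x)](s)=\int_0^s x(s-t)x(t)\,dt$, with Fréchet derivative $[F'(x)h](s)=2\int_0^s x(s-t)h(t)\,dt$. **Proposition.** Let $\sigma>0$ and $L\in\mathbb R$. Let $x_0\in W^2_\infty(0,1)$ be positive with $x_0(0)>0$. Assume that $F'(x_0)$ is accretive on $L_2^\sigma(0,1)$, i.e. $\langle F'(x_0)v,v\rangle_\sigma\ge 0$ for all $v$, and that $\omega\in L_2(0,1)$ solves $F'(x_0)\omega=x_0-x_0(0)$ and satisfies $\|\omega\|_\sigma<\tfrac14$. Then there is a constant $c>0$, depending only on $\sigma$, $L$, $x_0$ (and $\omega$), such that the following holds. Let $(X_m)_{m\ge1}$ be any subspaces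 of $L_2(0,1)$ with $\dim X_m=m$ and $$\inf_{z\in X_m}\|x-z\|_\sigma\le \frac Lm\|x\|_{1,\sigma}\qquad\text{for all }x\in H_1^\sigma(0,1),\ m\ge1 .$$ Let $0<\delta\le 1$, let $m\in\mathbb N$ satisfy $m\ge\sigma/\delta$, let $y^\delta\in L_2(0,1)$ satisfy $\|y^\delta-F(x_0)\|_\infty\le\delta$, and let $\alpha\ge c\sqrt\delta$. Let $Q$ be the $\langle\cdot,\cdot\rangle_\sigma$-orthogonal projection onto $X_m$. Let $A$ be the mean of $y^\delta$ over that cell of the partition of $[0,1]$ into $m$ intervals $[\tfrac{i-1}m,\tfrac im)$ (the last one closed) which contains $\sqrt\delta$, and let $x_*$ be the constant function with value $\sqrt{A/\sqrt\delta}$ if $A\ge0$ and $0$ otherwise. Put $H_\alpha=\alpha\,\mathrm{Id}+QF'(x_0)Q$. Then $H_\alpha$ is continuously invertible on $L_2^\sigma(0,1)$, and the map $$G(z)=x_0+H_\alpha^{-1}\Big(Q\big(F'(x_0)(x_0-Qx_0)+y^\delta-F(x_0)-F(z-x_0)\big)+\alpha(Qx_*-x_0)\Big)$$ has the following properties. 1.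 For $z\in X_m$, $G(z)=z$ holds if and only if $z$ solves the discretized Lavrentiev equation $\alpha Q(x_*-z)+Qy^\delta=QF(Qz)$. 2. There is $r>0$ such that, with the closed ball $B(x_0,r)=\{x:\|x-x_0\|_\sigma\le r\}$, $$G\big(B(x_0,r)\cap X_m\big)\subset B(x_0,r)\cap X_m ,$$ and $G$ has a fixed point in $B(x_0,r)\cap X_m$. -/

import Mathlib

open MeasureTheory Set
open scoped ENNReal

noncomputable section

/-- The finite measure `exp (-2 * σ * t) dt` on the interval `(0, 1)`. -/
def weightMeasure (σ : ℝ) : Measure ℝ :=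
  (volume.restrict (Ioo (0 : ℝ) 1)).withDensity
    (fun t => ENNReal.ofReal (Real.exp (-2 * σ * t)))

theorem measurable_weight (σ : ℝ) :
    Measurable (fun t : ℝ => ENNReal.ofReal (Real.exp (-2 * σ * t))) := by
  fun_prop

instance isFiniteMeasure_weightMeasure (σ : ℝ) : IsFiniteMeasure (weightMeasure σ) := by
  apply isFiniteMeasure_withDensity_ofReal
  have h : IntegrableOn (fun t : ℝ => Real.exp (-2 * σ * t)) (Icc 0 1) :=
    (by fun_prop : Continuous fun t : ℝ => Real.exp (-2 * σ * t)).continuousOn.integrableOn_compact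
      isCompact_Icc
  exact (h.mono_set Ioo_subset_Icc_self).hasFiniteIntegral

theorem ae_weightMeasure_iff (σ : ℝ) {p : ℝ → Prop} :
    (∀ᵐ t ∂(weightMeasure σ), p t) ↔ ∀ᵐ t ∂(volume.restrict (Ioo (0 : ℝ) 1)), p t := by
  constructor
  · intro h
    refine (withDensity_absolutelyContinuous' (measurable_weight σ).aemeasurable ?_).ae_le h
    exact Filter.Eventually.of_forall fun t => by simp [Real.exp_pos]
  · intro h
    exact (withDensity_absolutelyContinuous _ _).ae_le h

/-- The weighted space `L₂^σ(0, 1)`, with inner product `∫₀¹ exp (-2 * σ * t) x(t) y(t) dt`. -/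
abbrev WL2 (σ : ℝ) : Type := Lp ℝ 2 (weightMeasure σ)

theorem inner_WL2_eq (σ : ℝ) (x y : WL2 σ) :
    inner ℝ x y = ∫ t in (0 : ℝ)..1, Real.exp (-2 * σ * t) * (x t * y t) := by
  rw [L2.inner_def]
  unfold weightMeasure
  rw [integral_withDensity_eq_integral_toReal_smul (measurable_weight σ) (by simp),
    intervalIntegral.integral_of_le zero_le_one, integral_Ioc_eq_integral_Ioo]
  congr 1
  ext t
  rw [ENNReal.toReal_ofReal (Real.exp_pos _).le]
  simp [mul_comm]

theorem eLpNorm_weightMeasure (σ : ℝ) {u : ℝ → ℝ} (hu : Measurable u) :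
    eLpNorm u 2 (weightMeasure σ) =
      (∫⁻ t in Ioo (0 : ℝ) 1, (ENNReal.ofReal (Real.exp (-σ * t)) * ‖u t‖ₑ) ^ (2 : ℝ))
        ^ (1 / (2 : ℝ)) := by
  rw [eLpNorm_eq_lintegral_rpow_enorm_toReal (by norm_num) (by norm_num), weightMeasure,
    lintegral_withDensity_eq_lintegral_mul _ (measurable_weight σ) (by fun_prop)]
  congr 2
  · ext t
    simp only [Pi.mul_apply, ENNReal.toReal_ofNat]
    rw [ENNReal.mul_rpow_of_nonneg _ _ (by norm_num : (0 : ℝ) ≤ 2),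
      ENNReal.ofReal_rpow_of_pos (Real.exp_pos _), ← Real.exp_mul]
    congr 3
    ring_nf

/-- The (bilinear) convolution `(u ⋆ v)(s) = ∫₀ˢ u(s - t) v(t) dt` of functions. -/
def convFun (u v : ℝ → ℝ) (s : ℝ) : ℝ := ∫ t in (0 : ℝ)..s, u (s - t) * v t

theorem lintegral_conv_le (σ : ℝ) {u v : ℝ → ℝ} (hu : Measurable u) (hv : Measurable v)
    {s : ℝ} (hs : s ∈ Ioo (0 : ℝ) 1) :
    ∫⁻ t in Ioo (0 : ℝ) s, ‖u (s - t) * v t‖ₑ ≤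
      ENNReal.ofReal (Real.exp (σ * s)) *
        (eLpNorm u 2 (weightMeasure σ) * eLpNorm v 2 (weightMeasure σ)) := by
  set U : ℝ → ℝ≥0∞ := fun t => ENNReal.ofReal (Real.exp (-σ * t)) * ‖u t‖ₑ with hU
  set V : ℝ → ℝ≥0∞ := fun t => ENNReal.ofReal (Real.exp (-σ * t)) * ‖v t‖ₑ with hV
  have hUm : Measurable U := by fun_prop
  have hVm : Measurable V := by fun_prop
  have h1 : ∀ t, ‖u (s - t) * v t‖ₑ =
      ENNReal.ofReal (Real.exp (σ * s)) * ((fun t => U (s - t)) * V) t := by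
    intro t
    simp only [hU, hV, Pi.mul_apply]
    have : ENNReal.ofReal (Real.exp (σ * s)) * (ENNReal.ofReal (Real.exp (-σ * (s - t))) *
        ENNReal.ofReal (Real.exp (-σ * t))) = 1 := by
      rw [← ENNReal.ofReal_mul (Real.exp_pos _).le, ← ENNReal.ofReal_mul (Real.exp_pos _).le,
        ← Real.exp_add, ← Real.exp_add]
      ring_nf
      simp
    rw [enorm_mul]
    calc _ = 1 * (‖u (s - t)‖ₑ * ‖v t‖ₑ) := by rw [one_mul]
      _ = _ := by rw [← this]; ring
  simp_rw [h1]
  rw [lintegral_const_mul _ (by fun_prop)]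
  gcongr
  refine (ENNReal.lintegral_mul_le_Lp_mul_Lq _ Real.HolderConjugate.two_two
    (by fun_prop) (by fun_prop)).trans ?_
  rw [eLpNorm_weightMeasure σ hu, eLpNorm_weightMeasure σ hv]
  have hsub : Ioo (0 : ℝ) s ⊆ Ioo 0 1 := Ioo_subset_Ioo_right hs.2.le
  have hpre : (fun t => s - t) ⁻¹' (Ioo (0 : ℝ) s) = Ioo 0 s := by
    ext t; simp only [mem_preimage, mem_Ioo]; constructor <;> rintro ⟨h, h'⟩ <;>
      constructor <;> linarith
  have h2 := (Measure.measurePreserving_sub_left (volume : Measure ℝ) s).setLIntegral_comp_preimage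
    (measurableSet_Ioo (a := (0 : ℝ)) (b := s)) (f := fun t => U t ^ (2 : ℝ)) (by fun_prop)
  rw [hpre] at h2
  rw [h2]
  exact mul_le_mul' (ENNReal.rpow_le_rpow (lintegral_mono_set hsub) (by norm_num))
    (ENNReal.rpow_le_rpow (lintegral_mono_set hsub) (by norm_num))

theorem measurable_Lp {σ : ℝ} (u : WL2 σ) : Measurable (u : ℝ → ℝ) :=
  (Lp.stronglyMeasurable u).measurable

theorem integrableOn_conv {σ : ℝ} (u v : WL2 σ) {s : ℝ} (hs : s ∈ Ioo (0 : ℝ) 1) :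
    IntervalIntegrable (fun t => u (s - t) * v t) volume 0 s := by
  have hu := measurable_Lp u
  have hv := measurable_Lp v
  rw [intervalIntegrable_iff_integrableOn_Ioo_of_le hs.1.le]
  refine ⟨Measurable.aestronglyMeasurable (by fun_prop), ?_⟩
  refine (lintegral_conv_le σ hu hv hs).trans_lt ?_
  exact ENNReal.mul_lt_top ENNReal.ofReal_lt_top
    (ENNReal.mul_lt_top (Lp.eLpNorm_lt_top u) (Lp.eLpNorm_lt_top v))

theorem abs_convFun_le {σ : ℝ} (u v : WL2 σ) {s : ℝ} (hs : s ∈ Ioo (0 : ℝ) 1) :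
    |convFun u v s| ≤ Real.exp (σ * s) * (‖u‖ * ‖v‖) := by
  have hu := measurable_Lp u
  have hv := measurable_Lp v
  have h := lintegral_conv_le σ hu hv hs
  have h2 : ‖convFun u v s‖ₑ ≤ ENNReal.ofReal (Real.exp (σ * s) * (‖u‖ * ‖v‖)) := by
    rw [convFun, intervalIntegral.integral_of_le hs.1.le, integral_Ioc_eq_integral_Ioo]
    refine (enorm_integral_le_lintegral_enorm _).trans (h.trans ?_)
    rw [ENNReal.ofReal_mul (Real.exp_pos _).le, ENNReal.ofReal_mul (norm_nonneg _), Lp.norm_def,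
      Lp.norm_def, ENNReal.ofReal_toReal (Lp.eLpNorm_ne_top u),
      ENNReal.ofReal_toReal (Lp.eLpNorm_ne_top v)]
  rw [← Real.norm_eq_abs, ← toReal_enorm]
  exact ENNReal.toReal_le_of_le_ofReal (by positivity) h2

theorem aestronglyMeasurable_convFun {σ : ℝ} (u v : WL2 σ) :
    AEStronglyMeasurable (convFun u v) (weightMeasure σ) := by
  have hu := measurable_Lp u
  have hv := measurable_Lp v
  have hS : MeasurableSet {p : ℝ × ℝ | p.2 ∈ Ioc 0 p.1} := by
    simp only [mem_Ioc]
    exact (measurableSet_lt measurable_const measurable_snd).inter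
      (measurableSet_le measurable_snd measurable_fst)
  have hm : Measurable ({p : ℝ × ℝ | p.2 ∈ Ioc 0 p.1}.indicator
      (fun p : ℝ × ℝ => u (p.1 - p.2) * v p.2)) :=
    Measurable.indicator (by fun_prop) hS
  have hsm := hm.stronglyMeasurable.integral_prod_right' (ν := volume)
  refine hsm.aestronglyMeasurable.congr ?_
  refine (ae_weightMeasure_iff σ).2 ?_
  filter_upwards [ae_restrict_mem measurableSet_Ioo] with s hs
  rw [convFun, intervalIntegral.integral_of_le hs.1.le, ← integral_indicator measurableSet_Ioc]
  rfl

theorem eLpNorm_convFun_le {σ : ℝ} (u v : WL2 σ) :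
    eLpNorm (convFun u v) 2 (weightMeasure σ) ≤ ENNReal.ofReal (‖u‖ * ‖v‖) := by
  obtain ⟨g, hg, hgu⟩ := aestronglyMeasurable_convFun u v
  rw [eLpNorm_congr_ae hgu, eLpNorm_weightMeasure σ hg.measurable]
  have hae := (ae_weightMeasure_iff σ).1 hgu
  have : ∫⁻ t in Ioo (0 : ℝ) 1, (ENNReal.ofReal (Real.exp (-σ * t)) * ‖g t‖ₑ) ^ (2 : ℝ) ≤
      ∫⁻ t in Ioo (0 : ℝ) 1, ENNReal.ofReal (‖u‖ * ‖v‖) ^ (2 : ℝ) := by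
    refine lintegral_mono_ae ?_
    filter_upwards [hae, ae_restrict_mem measurableSet_Ioo] with s h hs
    rw [← h]
    gcongr
    rw [Real.enorm_eq_ofReal_abs, ← ENNReal.ofReal_mul (Real.exp_pos _).le]
    refine ENNReal.ofReal_le_ofReal ?_
    calc Real.exp (-σ * s) * |convFun u v s|
        ≤ Real.exp (-σ * s) * (Real.exp (σ * s) * (‖u‖ * ‖v‖)) := by
          gcongr; exact abs_convFun_le u v hs
      _ = ‖u‖ * ‖v‖ := by
          rw [← mul_assoc, ← Real.exp_add]; simp
  refine (ENNReal.rpow_le_rpow this (by norm_num)).trans ?_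
  rw [setLIntegral_const, Real.volume_Ioo]
  simp only [sub_zero, ENNReal.ofReal_one, mul_one]
  rw [← ENNReal.rpow_mul]
  norm_num

theorem memLp_convFun {σ : ℝ} (u v : WL2 σ) : MemLp (convFun u v) 2 (weightMeasure σ) :=
  ⟨aestronglyMeasurable_convFun u v, (eLpNorm_convFun_le u v).trans_lt ENNReal.ofReal_lt_top⟩

theorem convFun_congr {σ : ℝ} {u u' v v' : ℝ → ℝ} (hu : u =ᵐ[weightMeasure σ] u')
    (hv : v =ᵐ[weightMeasure σ] v') {s : ℝ} (hs : s ∈ Ioo (0 : ℝ) 1) :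
    convFun u v s = convFun u' v' s := by
  rw [convFun, convFun]
  refine intervalIntegral.integral_congr_ae_restrict ?_
  rw [uIoc_of_le hs.1.le, ← restrict_Ioo_eq_restrict_Ioc]
  have hu' := (ae_restrict_iff' measurableSet_Ioo).1 ((ae_weightMeasure_iff σ).1 hu)
  have hv' := (ae_restrict_iff' measurableSet_Ioo).1 ((ae_weightMeasure_iff σ).1 hv)
  have hu2 := (quasiMeasurePreserving_sub_left (volume : Measure ℝ) s).ae hu'
  filter_upwards [ae_restrict_of_ae hu2, ae_restrict_of_ae hv',
    ae_restrict_mem measurableSet_Ioo] with t h1 h2 ht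
  rw [h1 ⟨by linarith [ht.2], by linarith [ht.1, hs.2]⟩, h2 ⟨ht.1, ht.2.trans hs.2⟩]

/-- Convolution as a bounded bilinear map on `L₂^σ(0, 1)`. -/
def convL (σ : ℝ) : WL2 σ →L[ℝ] WL2 σ →L[ℝ] WL2 σ :=
  LinearMap.mkContinuous₂
    (LinearMap.mk₂ ℝ (fun u v => (memLp_convFun u v).toLp (convFun u v))
      (by
        intro u u' v
        rw [← MemLp.toLp_add, MemLp.toLp_eq_toLp_iff, Filter.EventuallyEq, ae_weightMeasure_iff]
        filter_upwards [ae_restrict_mem measurableSet_Ioo] with s hs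
        rw [convFun_congr (Lp.coeFn_add u u') (Filter.EventuallyEq.refl _ v) hs]
        simp only [convFun, Pi.add_apply, add_mul]
        exact intervalIntegral.integral_add (integrableOn_conv u v hs) (integrableOn_conv u' v hs))
      (by
        intro c u v
        rw [← MemLp.toLp_const_smul, MemLp.toLp_eq_toLp_iff, Filter.EventuallyEq,
          ae_weightMeasure_iff]
        filter_upwards [ae_restrict_mem measurableSet_Ioo] with s hs
        rw [convFun_congr (Lp.coeFn_smul c u) (Filter.EventuallyEq.refl _ v) hs]
        simp only [convFun, Pi.smul_apply, smul_eq_mul, mul_assoc]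
        exact intervalIntegral.integral_const_mul _ _)
      (by
        intro u v v'
        rw [← MemLp.toLp_add, MemLp.toLp_eq_toLp_iff, Filter.EventuallyEq, ae_weightMeasure_iff]
        filter_upwards [ae_restrict_mem measurableSet_Ioo] with s hs
        rw [convFun_congr (Filter.EventuallyEq.refl _ u) (Lp.coeFn_add v v') hs]
        simp only [convFun, Pi.add_apply, mul_add]
        exact intervalIntegral.integral_add (integrableOn_conv u v hs) (integrableOn_conv u v' hs))
      (by
        intro c u v
        rw [← MemLp.toLp_const_smul, MemLp.toLp_eq_toLp_iff, Filter.EventuallyEq,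
          ae_weightMeasure_iff]
        filter_upwards [ae_restrict_mem measurableSet_Ioo] with s hs
        rw [convFun_congr (Filter.EventuallyEq.refl _ u) (Lp.coeFn_smul c v) hs]
        simp only [convFun, Pi.smul_apply, smul_eq_mul, mul_left_comm _ c]
        exact intervalIntegral.integral_const_mul _ _))
    1
    (by
      intro u v
      simp only [LinearMap.mk₂_apply, Lp.norm_toLp, one_mul]
      exact ENNReal.toReal_le_of_le_ofReal (by positivity) (eLpNorm_convFun_le u v))

theorem convL_coeFn {σ : ℝ} (u v : WL2 σ) :
    convL σ u v =ᵐ[weightMeasure σ] fun s => ∫ t in (0 : ℝ)..s, u (s - t) * v t :=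
  MemLp.coeFn_toLp (memLp_convFun u v)

theorem convL_comm {σ : ℝ} (u v : WL2 σ) : convL σ u v = convL σ v u := by
  refine Lp.ext ?_
  filter_upwards [convL_coeFn u v, convL_coeFn v u] with s h1 h2
  rw [h1, h2]
  have := intervalIntegral.integral_comp_sub_left (a := 0) (b := s)
    (fun t => v (s - t) * u t) s
  simp only [sub_sub_cancel, sub_zero, sub_self] at this
  rw [← this]
  simp_rw [mul_comm]

/-- The autoconvolution operator `[F(x)](s) = ∫₀ˢ x(s - t) x(t) dt` on `L₂^σ(0, 1)`. -/
def autoconv {σ : ℝ} (x : WL2 σ) : WL2 σ := convL σ x x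

/-- The linear operator `[F'(x) h](s) = 2 ∫₀ˢ x(s - t) h(t) dt` on `L₂^σ(0, 1)`. -/
def autoconvDeriv {σ : ℝ} (x : WL2 σ) : WL2 σ →L[ℝ] WL2 σ := (2 : ℝ) • convL σ x

theorem hasFDerivAt_autoconv {σ : ℝ} (x : WL2 σ) :
    HasFDerivAt autoconv (autoconvDeriv x) x := by
  have h := (convL σ).hasFDerivAt_of_bilinear (hasFDerivAt_id x) (hasFDerivAt_id x)
  refine h.congr_fderiv ?_
  ext1 h
  simp [autoconvDeriv, convL_comm h x, two_smul]

/-- `f` is absolutely continuous on `[0, 1]` with (weak) derivative `g`: `g` is integrable on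
`(0, 1)` and `f` is its indefinite integral on `[0, 1]`. -/
def HasACDeriv (f g : ℝ → ℝ) : Prop :=
  IntegrableOn g (Ioo (0 : ℝ) 1) ∧ ∀ t ∈ Icc (0 : ℝ) 1, f t = f 0 + ∫ s in (0 : ℝ)..t, g s

/-- `f` is the continuous representative on `[0, 1]` of an element of `W²_∞(0, 1)`: the second
weak derivative exists and is essentially bounded (`f` and `f'` are then continuous on `[0, 1]`,
hence bounded, so that `f ∈ C¹[0, 1]`). -/
def MemW2Infty (f : ℝ → ℝ) : Prop :=
  ∃ f₁ f₂ : ℝ → ℝ, HasACDeriv f f₁ ∧ HasACDeriv f₁ f₂ ∧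
    MemLp f₂ ∞ (volume.restrict (Ioo (0 : ℝ) 1))

/-- `x ∈ L₂^σ(0, 1)` has an absolutely continuous representative, with weak derivative
`x' ∈ L₂^σ(0, 1)`; in other words, `x` belongs to `H₁^σ(0, 1)` with derivative `x'`. -/
def HasWeakDeriv {σ : ℝ} (x x' : WL2 σ) : Prop :=
  ∃ f : ℝ → ℝ, x =ᵐ[weightMeasure σ] f ∧ HasACDeriv f x'

/-- The norm `‖x‖_{1,σ} = ½ (‖x‖_σ² + ‖x'‖_σ²)^{1/2}` of an element of `H₁^σ(0, 1)` with weak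
derivative `x'`. -/
def sobolevNorm {σ : ℝ} (x x' : WL2 σ) : ℝ := 1 / 2 * √(‖x‖ ^ 2 + ‖x'‖ ^ 2)

/-- The subspaces `X m`, `m = 1, 2, …`, of `L₂^σ(0, 1)` have dimension `m` and approximation
power `1 / m` with constant `L` on `H₁^σ(0, 1)`. -/
def ApproximationPower {σ : ℝ} (L : ℝ) (X : ℕ → Submodule ℝ (WL2 σ)) : Prop :=
  ∀ m : ℕ, 1 ≤ m → Module.finrank ℝ (X m) = m ∧
    ∀ x x' : WL2 σ, HasWeakDeriv x x' → ⨅ z : X m, ‖x - z‖ ≤ L / m * sobolevNorm x x'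

/-- `A` is accretive: `⟨A v, v⟩ ≥ 0` for all `v`. -/
def IsAccretive {E : Type*} [NormedAddCommGroup E] [InnerProductSpace ℝ E] (A : E →L[ℝ] E) :
    Prop :=
  ∀ v, 0 ≤ inner ℝ (A v) v

/-- The value at `s ∈ [0, 1]` of the `L₂(0, 1)`-orthogonal projection of `y` onto the piecewise
constant functions for the partition of `[0, 1]` into `m` cells of length `1 / m`: the mean of `y`
over the cell `[i / m, (i + 1) / m)` that contains `s` (the last cell includes `s = 1`). -/
def cellAverage (m : ℕ) (y : ℝ → ℝ) (s : ℝ) : ℝ :=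
  let i : ℕ := min ⌊m * s⌋₊ (m - 1)
  m * ∫ t in (i / m : ℝ)..((i + 1) / m : ℝ), y t

/-- The value of the constant reference element `x_*`, an estimate of `x₀(0)` from the data. -/
def referenceValue (m : ℕ) (δ : ℝ) (y : ℝ → ℝ) : ℝ :=
  if 0 ≤ cellAverage m y (√δ) then √(1 / √δ * cellAverage m y (√δ)) else 0

/-- The reference element `x_*`, a constant function. -/
def referenceElement {σ : ℝ} (m : ℕ) (δ : ℝ) (y : WL2 σ) : WL2 σ :=
  Lp.const 2 (weightMeasure σ) (referenceValue m δ y)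

/-- The operator `H_α = α Id + Q F'(x₀) Q`. -/
def regOp {σ : ℝ} (α : ℝ) (Q : WL2 σ →L[ℝ] WL2 σ) (x₀ : WL2 σ) : WL2 σ →L[ℝ] WL2 σ :=
  α • ContinuousLinearMap.id ℝ (WL2 σ) + Q ∘L autoconvDeriv x₀ ∘L Q

/-- The fixed-point map
`G(z) = x₀ + H_α⁻¹ (Q (F'(x₀)(x₀ - Q x₀) + y - F(x₀) - F(z - x₀)) + α (Q x_* - x₀))`. -/
def fixedPointMap {σ : ℝ} (α : ℝ) (Q : WL2 σ →L[ℝ] WL2 σ) (x₀ xs y z : WL2 σ) : WL2 σ :=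
  x₀ + (regOp α Q x₀).inverse
    (Q (autoconvDeriv x₀ (x₀ - Q x₀) + y - autoconv x₀ - autoconv (z - x₀)) + α • (Q xs - x₀))

end

/-! ### Accretive operators on a Hilbert space. -/

section Accretive

variable {E : Type*} [NormedAddCommGroup E] [InnerProductSpace ℝ E]

/-! Put `d = G(z) - x₀` and `A = Q F'(x₀) Q`, which inherits accretivity, so that `H_α = α + A` is
invertible with `‖H_α⁻¹‖ ≤ 1/α`. Since `F` is quadratic, its Taylor expansion at `x₀` is exact with
remainder `F(z - x₀)`, of norm at most `‖z - x₀‖²`. It turns the definition of `G` into `H_α G(z) =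
Q(F'(x₀)z + y - F(z)) + αQx_*`; hence `G` takes values in `X_m`, and its fixed points there solve
the Lavrentiev equation.

For the ball, the source condition `x₀ = x₀(0) + F'(x₀)ω` rewrites the bias `α(Qx_* - x₀)` as `-αAω`
plus small terms. A bound by `1/α` alone would lose the factor `α` of `αAω`, but `A` commutes with
`H_α⁻¹` and `‖A H_α⁻¹‖ ≤ 1`, so this term contributes at most `α‖ω‖`
(`IsAccretive.norm_le_of_source`). The other errors are of order `δ + α√δ`: `x₀` and `ω` lie in
`H₁^σ` (for `ω` by differentiating its Volterra equation), so projection costs `O(1/m) = O(δ)`, and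
`x_*` estimates `x₀(0)` up to `O(√δ)` because `F(x₀)(s) = x₀(0)² s + O(s²)`. Thus `α ≥ c√δ` makes
them at most `εα²`.

With `r = ρα` this gives `‖d‖ ≤ (ρ² + ε + ‖ω‖)α`. The inequality `ρ² + ‖ω‖ < ρ` has a solution `ρ <
1/2` exactly because `‖ω‖ < 1/4`. The Lipschitz constant of `G` on the ball is then at most `2ρ <
1`, and Banach's theorem applies. -/

/-- Lax–Milgram for the bilinear form `⟨T v, w⟩`. -/
theorem isInvertible_of_coercive [CompleteSpace E] {T : E →L[ℝ] E} {α : ℝ} (hα : 0 < α)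
    (hT : ∀ v, α * ‖v‖ ^ 2 ≤ inner ℝ (T v) v) : T.IsInvertible := by
  have hB : IsCoercive ((innerSL ℝ : E →L[ℝ] E →L[ℝ] ℝ) ∘L T) :=
    ⟨α, hα, fun u => by
      have := hT u
      rwa [pow_two, ← mul_assoc] at this⟩
  refine ⟨hB.continuousLinearEquivOfBilin, ?_⟩
  ext v
  refine ext_inner_right ℝ fun w => ?_
  exact hB.continuousLinearEquivOfBilin_apply v w

theorem IsAccretive.inner_smul_id_add {A : E →L[ℝ] E} (hA : IsAccretive A) (α : ℝ) (v : E) :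
    α * ‖v‖ ^ 2 ≤ inner ℝ (α • v + A v) v := by
  have := hA v
  rw [inner_add_left, real_inner_smul_left, real_inner_self_eq_norm_sq]
  linarith

theorem IsAccretive.mul_norm_le {A : E →L[ℝ] E} (hA : IsAccretive A) (α : ℝ) (v : E) :
    α * ‖v‖ ≤ ‖α • v + A v‖ := by
  rcases eq_or_ne v 0 with rfl | hv
  · simp
  have h := (hA.inner_smul_id_add α v).trans (real_inner_le_norm _ _)
  have hv' : 0 < ‖v‖ := norm_pos_iff.2 hv
  nlinarith

/-- In the expansion of `‖α v + A v‖²` the cross term `2α⟨A v, v⟩` is nonnegative. -/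
theorem IsAccretive.norm_apply_le {A : E →L[ℝ] E} (hA : IsAccretive A) {α : ℝ} (hα : 0 ≤ α)
    (v : E) : ‖A v‖ ≤ ‖α • v + A v‖ := by
  refine le_of_sq_le_sq ?_ (norm_nonneg _)
  rw [norm_add_sq_real, real_inner_smul_left, real_inner_comm]
  have := mul_nonneg hα (hA v)
  nlinarith [sq_nonneg ‖α • v‖]

/-- The source term `αAw` costs only `α‖w‖`: with `w = (α + A)u` it equals `(α + A)(αAu)`, so it
shifts `d` by `αAu`, and `‖Au‖ ≤ ‖w‖`. -/
theorem IsAccretive.norm_le_of_source [CompleteSpace E] {A : E →L[ℝ] E} (hA : IsAccretive A)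
    {α : ℝ} (hα : 0 < α) (d w : E) :
    ‖d‖ ≤ ‖α • d + A d + α • A w‖ / α + α * ‖w‖ := by
  have hinv : (α • ContinuousLinearMap.id ℝ E + A).IsInvertible :=
    isInvertible_of_coercive hα fun v => by simpa using hA.inner_smul_id_add α v
  obtain ⟨u, rfl⟩ := hinv.surjective w
  simp only [add_apply, smul_apply,
    ContinuousLinearMap.id_apply]
  have h1 := hA.mul_norm_le α (d + α • A u)
  have h2 := hA.norm_apply_le hα.le u
  have h3 : α • (d + α • A u) + A (d + α • A u) =
      α • d + A d + α • A (α • u + A u) := by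
    simp only [map_add, map_smul]
    module
  rw [h3] at h1
  have h4 : ‖d + α • A u‖ ≤ ‖α • d + A d + α • A (α • u + A u)‖ / α := by
    rw [le_div_iff₀ hα]; linarith
  calc ‖d‖ = ‖(d + α • A u) - α • A u‖ := by rw [add_sub_cancel_right]
    _ ≤ ‖d + α • A u‖ + ‖α • A u‖ := norm_sub_le _ _
    _ ≤ _ := by
      rw [norm_smul, Real.norm_of_nonneg hα.le]
      gcongr

theorem IsAccretive.starProjection_comp {A : E →L[ℝ] E} (hA : IsAccretive A)
    (K : Submodule ℝ E) [K.HasOrthogonalProjection] :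
    IsAccretive (K.starProjection ∘L A ∘L K.starProjection) := by
  intro v
  simp only [ContinuousLinearMap.comp_apply]
  rw [Submodule.inner_starProjection_left_eq_right]
  exact hA _

end Accretive

/-! ### Norm bounds and exact Taylor expansion of the autoconvolution. -/

theorem regOp_apply {σ : ℝ} (α : ℝ) (Q : WL2 σ →L[ℝ] WL2 σ) (x₀ v : WL2 σ) :
    regOp α Q x₀ v = α • v + Q (autoconvDeriv x₀ (Q v)) := by
  simp [regOp]

theorem norm_convL_le {σ : ℝ} (u v : WL2 σ) : ‖convL σ u v‖ ≤ ‖u‖ * ‖v‖ := by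
  have h : ‖convL σ‖ ≤ 1 := LinearMap.mkContinuous₂_norm_le _ zero_le_one _
  calc ‖convL σ u v‖ ≤ ‖convL σ‖ * ‖u‖ * ‖v‖ := (convL σ).le_opNorm₂ u v
    _ ≤ 1 * ‖u‖ * ‖v‖ := by gcongr
    _ = _ := by rw [one_mul]

theorem norm_autoconv_le {σ : ℝ} (u : WL2 σ) : ‖autoconv u‖ ≤ ‖u‖ ^ 2 := by
  rw [pow_two]; exact norm_convL_le u u

theorem norm_autoconvDeriv_le {σ : ℝ} (u v : WL2 σ) :
    ‖autoconvDeriv u v‖ ≤ 2 * ‖u‖ * ‖v‖ := by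
  have := norm_convL_le u v
  simp only [autoconvDeriv, smul_apply, norm_smul, Real.norm_two]
  linarith

/-- By commutativity, `u ⋆ u - v ⋆ v = (u + v) ⋆ (u - v)`. -/
theorem norm_autoconv_sub_le {σ : ℝ} (u v : WL2 σ) :
    ‖autoconv u - autoconv v‖ ≤ (‖u‖ + ‖v‖) * ‖u - v‖ := by
  have h : autoconv u - autoconv v = convL σ (u + v) (u - v) := by
    simp only [autoconv, map_add, map_sub, add_apply]
    rw [convL_comm v u]
    abel
  rw [h]
  refine (norm_convL_le _ _).trans ?_
  gcongr
  exact norm_add_le _ _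

theorem autoconv_eq_add {σ : ℝ} (x z : WL2 σ) :
    autoconv z = autoconv x + autoconvDeriv x (z - x) + autoconv (z - x) := by
  simp only [autoconv, autoconvDeriv, map_sub, smul_apply, sub_apply]
  rw [convL_comm z x]
  module

/-! ### The fixed-point map: invariance, fixed points, Lipschitz and centre estimates. -/

section FixedPointMap

variable {σ α : ℝ} {x₀ : WL2 σ} (K : Submodule ℝ (WL2 σ)) [K.HasOrthogonalProjection]

theorem isInvertible_regOp (hα : 0 < α) (hacc : IsAccretive (autoconvDeriv x₀)) :
    (regOp α K.starProjection x₀).IsInvertible := by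
  refine isInvertible_of_coercive hα fun v => ?_
  rw [regOp_apply]
  exact (hacc.starProjection_comp K).inner_smul_id_add α v

theorem regOp_fixedPointMap_sub (hα : 0 < α) (hacc : IsAccretive (autoconvDeriv x₀))
    (xs y z : WL2 σ) :
    regOp α K.starProjection x₀ (fixedPointMap α K.starProjection x₀ xs y z - x₀) =
      K.starProjection (autoconvDeriv x₀ (x₀ - K.starProjection x₀) + y - autoconv x₀ -
        autoconv (z - x₀)) + α • (K.starProjection xs - x₀) := by
  rw [fixedPointMap, add_sub_cancel_left, (isInvertible_regOp K hα hacc).self_apply_inverse]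

/-- Taylor's formula removes `x₀` from the right-hand side except through `F'(x₀)z`; what is left
visibly lies in `K`. -/
theorem regOp_fixedPointMap (hα : 0 < α) (hacc : IsAccretive (autoconvDeriv x₀))
    (xs y z : WL2 σ) :
    regOp α K.starProjection x₀ (fixedPointMap α K.starProjection x₀ xs y z) =
      K.starProjection (autoconvDeriv x₀ z + y - autoconv z) + α • K.starProjection xs := by
  have h := regOp_fixedPointMap_sub K hα hacc xs y z
  rw [map_sub, sub_eq_iff_eq_add] at h
  rw [h, regOp_apply, autoconv_eq_add x₀ z]
  simp only [map_sub, map_add, smul_sub]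
  abel

theorem fixedPointMap_mem (hα : 0 < α) (hacc : IsAccretive (autoconvDeriv x₀))
    (xs y z : WL2 σ) : fixedPointMap α K.starProjection x₀ xs y z ∈ K := by
  have h := regOp_fixedPointMap K hα hacc xs y z
  rw [regOp_apply, ← eq_sub_iff_add_eq] at h
  have h2 : α • fixedPointMap α K.starProjection x₀ xs y z ∈ K := by
    rw [h]
    exact K.sub_mem (K.add_mem (Submodule.starProjection_apply_mem _ _)
      (K.smul_mem _ (Submodule.starProjection_apply_mem _ _)))
      (Submodule.starProjection_apply_mem _ _)
  exact (K.smul_mem_iff hα.ne').1 h2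

theorem fixedPointMap_eq_self_iff (hα : 0 < α) (hacc : IsAccretive (autoconvDeriv x₀))
    (xs y : WL2 σ) {z : WL2 σ} (hz : z ∈ K) :
    fixedPointMap α K.starProjection x₀ xs y z = z ↔
      α • K.starProjection (xs - z) + K.starProjection y =
        K.starProjection (autoconv (K.starProjection z)) := by
  have hQz : K.starProjection z = z := Submodule.starProjection_eq_self_iff.2 hz
  rw [← (isInvertible_regOp K hα hacc).injective.eq_iff, regOp_fixedPointMap K hα hacc,
    regOp_apply]
  simp only [map_sub, map_add, smul_sub, hQz]
  constructor <;> intro h <;>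
  · rw [← sub_eq_zero] at h ⊢
    rw [← h]
    abel

/-- Only the remainder `F(z - x₀)` depends on `z`; the factor `1/α` is the bound on the inverse. -/
theorem norm_fixedPointMap_sub_le (hα : 0 < α) (hacc : IsAccretive (autoconvDeriv x₀))
    (xs y z z' : WL2 σ) :
    ‖fixedPointMap α K.starProjection x₀ xs y z - fixedPointMap α K.starProjection x₀ xs y z'‖ ≤
      (‖z - x₀‖ + ‖z' - x₀‖) / α * ‖z - z'‖ := by
  set G := fixedPointMap α K.starProjection x₀ xs y
  have h1 : regOp α K.starProjection x₀ (G z - G z') =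
      K.starProjection (autoconv (z' - x₀) - autoconv (z - x₀)) := by
    have h : G z - G z' = (G z - x₀) - (G z' - x₀) := by abel
    rw [h, map_sub, regOp_fixedPointMap_sub K hα hacc, regOp_fixedPointMap_sub K hα hacc]
    simp only [map_sub, map_add]
    abel
  have h2 := (hacc.starProjection_comp K).mul_norm_le α (G z - G z')
  simp only [ContinuousLinearMap.comp_apply] at h2
  rw [← regOp_apply, h1] at h2
  have h3 := (K.norm_starProjection_apply_le (autoconv (z' - x₀) - autoconv (z - x₀))).trans
    (norm_autoconv_sub_le _ _)
  rw [sub_sub_sub_cancel_right, norm_sub_rev z' z, add_comm] at h3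
  rw [div_mul_eq_mul_div, le_div_iff₀ hα]
  linarith

theorem norm_fixedPointMap_sub_center_le (hα : 0 < α) (hacc : IsAccretive (autoconvDeriv x₀))
    {w : WL2 σ} {a b : ℝ} (hw : autoconvDeriv x₀ w = x₀ - Lp.const 2 (weightMeasure σ) a)
    (y z : WL2 σ) :
    ‖fixedPointMap α K.starProjection x₀ (Lp.const 2 (weightMeasure σ) b) y z - x₀‖ ≤
      (2 * ‖x₀‖ * ‖x₀ - K.starProjection x₀‖ + ‖y - autoconv x₀‖ + ‖z - x₀‖ ^ 2
        + α * ‖Lp.const 2 (weightMeasure σ) (b - a)‖ + α * ‖x₀ - K.starProjection x₀‖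
        + α * (2 * ‖x₀‖ * ‖w - K.starProjection w‖)) / α + α * ‖w‖ := by
  set Q := K.starProjection with hQ
  set d := fixedPointMap α Q x₀ (Lp.const 2 (weightMeasure σ) b) y z - x₀ with hd
  have hd' := regOp_fixedPointMap_sub K hα hacc (Lp.const 2 (weightMeasure σ) b) y z
  rw [← hQ, ← hd, regOp_apply] at hd'
  refine ((hacc.starProjection_comp K).norm_le_of_source hα d w).trans ?_
  gcongr
  simp only [ContinuousLinearMap.comp_apply, ← hQ]
  have hx : x₀ = autoconvDeriv x₀ w + Lp.const 2 (weightMeasure σ) a := by rw [hw]; abel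
  have hc : Lp.const 2 (weightMeasure σ) (b - a) =
      Lp.const 2 (weightMeasure σ) b - Lp.const 2 (weightMeasure σ) a := map_sub _ _ _
  have hQx : Q x₀ = Q (autoconvDeriv x₀ w) + Q (Lp.const 2 (weightMeasure σ) a) := by
    rw [← map_add, ← hx]
  -- `Q F' ω` is split as `Q F' Q ω + Q F'(ω - Q ω)`. The first part stays on the left as the source
  -- term; the second is a projection error.
  have key : α • d + Q (autoconvDeriv x₀ (Q d)) + α • Q (autoconvDeriv x₀ (Q w)) =
      Q (autoconvDeriv x₀ (x₀ - Q x₀)) + Q (y - autoconv x₀) - Q (autoconv (z - x₀)) +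
        α • Q (Lp.const 2 (weightMeasure σ) (b - a)) - α • (x₀ - Q x₀) -
        α • Q (autoconvDeriv x₀ (w - Q w)) := by
    rw [hd', hc]
    have e1 : α • Q x₀ = α • Q (autoconvDeriv x₀ w) + α • Q (Lp.const 2 (weightMeasure σ) a) := by
      rw [hQx, smul_add]
    simp only [map_sub, map_add, smul_sub]
    rw [e1]
    abel
  rw [key]
  have hn := fun v => K.norm_starProjection_apply_le v
  refine (norm_sub_le _ _).trans (add_le_add ((norm_sub_le _ _).trans (add_le_add
    ((norm_add_le _ _).trans (add_le_add ((norm_sub_le _ _).trans (add_le_add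
    ((norm_add_le _ _).trans (add_le_add ?_ ?_)) ?_)) ?_)) ?_)) ?_)
  · exact (hn _).trans (norm_autoconvDeriv_le _ _)
  · exact hn _
  · exact (hn _).trans (norm_autoconv_le _)
  · rw [norm_smul, Real.norm_of_nonneg hα.le]; gcongr; exact hn _
  · rw [norm_smul, Real.norm_of_nonneg hα.le]
  · rw [norm_smul, Real.norm_of_nonneg hα.le]; gcongr
    exact (hn _).trans (norm_autoconvDeriv_le _ _)

end FixedPointMap

/-! ### Weighted and Lebesgue measure; primitives as convolutions with `1`. -/

open scoped Convolution

theorem restrict_le_weightMeasure {σ : ℝ} (hσ : 0 ≤ σ) :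
    volume.restrict (Ioo (0 : ℝ) 1) ≤
      ENNReal.ofReal (Real.exp (2 * σ)) • weightMeasure σ := by
  rw [weightMeasure, ← withDensity_smul _ (measurable_weight σ)]
  conv_lhs => rw [← withDensity_one (μ := volume.restrict (Ioo (0 : ℝ) 1))]
  refine withDensity_mono ?_
  filter_upwards [ae_restrict_mem measurableSet_Ioo] with t ht
  simp only [Pi.one_apply, Pi.smul_apply, smul_eq_mul]
  rw [← ENNReal.ofReal_mul (Real.exp_pos _).le, ← Real.exp_add, ENNReal.one_le_ofReal,
    Real.one_le_exp_iff]
  nlinarith [ht.2]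

theorem weightMeasure_le_restrict {σ : ℝ} (hσ : 0 ≤ σ) :
    weightMeasure σ ≤ volume.restrict (Ioo (0 : ℝ) 1) := by
  rw [weightMeasure]
  conv_rhs => rw [← withDensity_one (μ := volume.restrict (Ioo (0 : ℝ) 1))]
  refine withDensity_mono ?_
  filter_upwards [ae_restrict_mem measurableSet_Ioo] with t ht
  simp only [Pi.one_apply]
  rw [ENNReal.ofReal_le_one, Real.exp_le_one_iff]
  nlinarith [ht.1]

theorem integrableOn_WL2 {σ : ℝ} (hσ : 0 ≤ σ) (u : WL2 σ) : IntegrableOn u (Ioo (0 : ℝ) 1) :=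
  (((Lp.memLp u).integrable one_le_two).smul_measure ENNReal.ofReal_ne_top).mono_measure
    (restrict_le_weightMeasure hσ)

theorem norm_const_le {σ : ℝ} (hσ : 0 ≤ σ) (a : ℝ) :
    ‖Lp.const 2 (weightMeasure σ) a‖ ≤ |a| := by
  refine (Lp.norm_const_le (p := 2) (μ := weightMeasure σ) (c := a)).trans ?_
  rw [Real.norm_eq_abs]
  refine mul_le_of_le_one_right (abs_nonneg a) (Real.rpow_le_one measureReal_nonneg ?_ ?_)
  · have h := weightMeasure_le_restrict hσ univ
    simp at h
    exact ENNReal.toReal_le_of_le_ofReal zero_le_one (by simpa using h)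
  · simp

/-- `1 ⋆ u` is the indefinite integral of `u`. -/
theorem convL_one_coeFn {σ : ℝ} (u : WL2 σ) {g : ℝ → ℝ} (hg : u =ᵐ[weightMeasure σ] g) :
    convL σ (Lp.const 2 (weightMeasure σ) 1) u =ᵐ[weightMeasure σ]
      fun s => ∫ t in (0 : ℝ)..s, g t := by
  have hmem : ∀ᵐ s ∂(weightMeasure σ), s ∈ Ioo (0 : ℝ) 1 :=
    (ae_weightMeasure_iff σ).2 (ae_restrict_mem measurableSet_Ioo)
  filter_upwards [convL_coeFn (Lp.const 2 (weightMeasure σ) (1 : ℝ)) u, hmem] with s hs hs'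
  have := convFun_congr (Lp.coeFn_const (p := 2) (μ := weightMeasure σ) (c := (1 : ℝ))) hg hs'
  rw [convFun] at this
  rw [hs, this, convFun]
  simp

theorem hasWeakDeriv_const_add {σ : ℝ} (hσ : 0 ≤ σ) (a : ℝ) (u : WL2 σ) :
    HasWeakDeriv (Lp.const 2 (weightMeasure σ) a +
      convL σ (Lp.const 2 (weightMeasure σ) 1) u) u := by
  refine ⟨fun t => a + ∫ s in (0 : ℝ)..t, u s, ?_, integrableOn_WL2 hσ u, fun t _ => by simp⟩
  filter_upwards [Lp.coeFn_add (Lp.const 2 (weightMeasure σ) a)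
      (convL σ (Lp.const 2 (weightMeasure σ) 1) u),
    Lp.coeFn_const (p := 2) (μ := weightMeasure σ) (c := a),
    convL_one_coeFn u (Filter.EventuallyEq.refl _ _)] with s h1 h2 h3
  rw [h1, Pi.add_apply, h2, h3]
  rfl

theorem HasACDeriv.eq_const_add {σ : ℝ} {f g : ℝ → ℝ} (h : HasACDeriv f g) {x u : WL2 σ}
    (hx : x =ᵐ[weightMeasure σ] f) (hu : u =ᵐ[weightMeasure σ] g) :
    x = Lp.const 2 (weightMeasure σ) (f 0) +
      convL σ (Lp.const 2 (weightMeasure σ) 1) u := by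
  refine Lp.ext ?_
  have hmem : ∀ᵐ s ∂(weightMeasure σ), s ∈ Ioo (0 : ℝ) 1 :=
    (ae_weightMeasure_iff σ).2 (ae_restrict_mem measurableSet_Ioo)
  filter_upwards [hx, hmem, Lp.coeFn_add (Lp.const 2 (weightMeasure σ) (f 0))
      (convL σ (Lp.const 2 (weightMeasure σ) 1) u),
    Lp.coeFn_const (p := 2) (μ := weightMeasure σ) (c := f 0),
    convL_one_coeFn u hu] with s h0 hs h1 h2 h3
  rw [h0, h1, Pi.add_apply, h2, h3, h.2 s (Ioo_subset_Icc_self hs)]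
  rfl

theorem HasACDeriv.intervalIntegrable {f g : ℝ → ℝ} (h : HasACDeriv f g) {t : ℝ}
    (ht : t ∈ Icc (0 : ℝ) 1) : IntervalIntegrable g volume 0 t := by
  rw [intervalIntegrable_iff_integrableOn_Ioo_of_le ht.1]
  exact h.1.mono_set (Ioo_subset_Ioo_right ht.2)

theorem HasACDeriv.continuousOn {f g : ℝ → ℝ} (h : HasACDeriv f g) :
    ContinuousOn f (Icc 0 1) := by
  have h1 : ContinuousOn (fun t => f 0 + ∫ s in (0 : ℝ)..t, g s) (Icc 0 1) := by
    refine continuousOn_const.add ?_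
    have := intervalIntegral.continuousOn_primitive_interval (μ := volume) (f := g) (a := 0)
      (b := 1) (by
        rw [uIcc_of_le zero_le_one]
        exact (integrableOn_Icc_iff_integrableOn_Ioo).2 h.1)
    rwa [uIcc_of_le zero_le_one] at this
  exact h1.congr h.2

/-- The primitive of `u` is continuous and vanishes a.e., hence on all of `(0, 1)`; Lebesgue
differentiation gives `u = 0` a.e. -/
theorem convL_one_injective {σ : ℝ} (hσ : 0 ≤ σ) {u : WL2 σ}
    (h : convL σ (Lp.const 2 (weightMeasure σ) 1) u = 0) : u = 0 := by
  set φ : ℝ → ℝ := fun s => ∫ t in (0 : ℝ)..s, u t with hφ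
  have hint := integrableOn_WL2 hσ u
  have hAC : HasACDeriv φ u := ⟨hint, fun t _ => by simp [hφ]⟩
  have h0 : φ =ᵐ[volume.restrict (Ioo (0 : ℝ) 1)] fun _ => (0 : ℝ) := by
    refine (ae_weightMeasure_iff σ).1 ?_
    have h1 := convL_one_coeFn u (Filter.EventuallyEq.refl _ _)
    rw [h] at h1
    filter_upwards [h1, Lp.coeFn_zero ℝ 2 (weightMeasure σ)] with s h2 h3
    exact h2.symm.trans h3
  have h1 : EqOn φ (fun _ => 0) (Ioo 0 1) :=
    Measure.eqOn_open_of_ae_eq h0 isOpen_Ioo (hAC.continuousOn.mono Ioo_subset_Icc_self)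
      continuousOn_const
  refine Lp.ext ?_
  refine Filter.EventuallyEq.trans ?_ (Lp.coeFn_zero ℝ 2 (weightMeasure σ)).symm
  refine (ae_weightMeasure_iff σ).2 ?_
  have hd := (hAC.intervalIntegrable (right_mem_Icc.2 zero_le_one)).ae_hasDerivAt_integral
  filter_upwards [ae_restrict_of_ae hd, ae_restrict_mem measurableSet_Ioo] with s hs hs'
  have h2 := hs (by rw [uIcc_of_le zero_le_one]; exact Ioo_subset_Icc_self hs') 0
    (by simp)
  have h3 : HasDerivAt φ 0 s :=
    (hasDerivAt_const s (0 : ℝ)).congr_of_eventuallyEq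
      (Filter.eventuallyEq_of_mem (isOpen_Ioo.mem_nhds hs') h1)
  exact h2.unique h3

/-! ### Associativity of convolution and the Volterra equation for `ω`. -/

section Associativity

theorem convolution_eq_convFun {U V : ℝ → ℝ} (hU : ∀ t ≤ 0, U t = 0) (hV : ∀ t ≤ 0, V t = 0)
    {s : ℝ} (hs : 0 ≤ s) :
    (U ⋆[ContinuousLinearMap.mul ℝ ℝ, volume] V) s = convFun U V s := by
  rw [convolution_mul_swap, convFun, intervalIntegral.integral_of_le hs,
    ← integral_indicator measurableSet_Ioc]
  congr 1
  ext t
  by_cases ht : t ∈ Ioc 0 s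
  · rw [indicator_of_mem ht]
  · rw [indicator_of_notMem ht]
    rcases le_or_gt t 0 with h | h
    · rw [hV t h, mul_zero]
    · rw [hU _ (by by_contra hh; exact ht ⟨h, by linarith⟩), zero_mul]

theorem convolution_eq_zero {U V : ℝ → ℝ} (hU : ∀ t ≤ 0, U t = 0) (hV : ∀ t ≤ 0, V t = 0)
    {s : ℝ} (hs : s ≤ 0) :
    (U ⋆[ContinuousLinearMap.mul ℝ ℝ, volume] V) s = 0 := by
  rw [convolution_mul_swap]
  refine integral_eq_zero_of_ae (Filter.Eventually.of_forall fun t => ?_)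
  simp only [Pi.zero_apply]
  rcases le_or_gt t 0 with h | h
  · rw [hV t h, mul_zero]
  · rw [hU _ (by linarith), zero_mul]

variable {σ : ℝ}

theorem indicator_eq_zero_of_nonpos (u : ℝ → ℝ) {t : ℝ} (ht : t ≤ 0) :
    (Ioo (0 : ℝ) 1).indicator u t = 0 :=
  indicator_of_notMem (fun h => absurd h.1 ht.not_gt) u

theorem indicator_ae_eq (u : ℝ → ℝ) :
    (Ioo (0 : ℝ) 1).indicator u =ᵐ[weightMeasure σ] u := by
  refine (ae_weightMeasure_iff σ).2 ?_
  filter_upwards [ae_restrict_mem measurableSet_Ioo] with s hs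
  exact indicator_of_mem hs u

theorem convL_ae_eq_convolution (u v : WL2 σ) :
    convL σ u v =ᵐ[weightMeasure σ] (Ioo (0 : ℝ) 1).indicator u
      ⋆[ContinuousLinearMap.mul ℝ ℝ, volume] (Ioo (0 : ℝ) 1).indicator v := by
  have hmem : ∀ᵐ s ∂(weightMeasure σ), s ∈ Ioo (0 : ℝ) 1 :=
    (ae_weightMeasure_iff σ).2 (ae_restrict_mem measurableSet_Ioo)
  filter_upwards [convL_coeFn u v, hmem] with s h hs
  rw [h, convolution_eq_convFun (fun t => indicator_eq_zero_of_nonpos _)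
    (fun t => indicator_eq_zero_of_nonpos _) hs.1.le]
  exact convFun_congr (σ := σ) (indicator_ae_eq u).symm (indicator_ae_eq v).symm hs

/-- After extension by zero, the truncated convolution agrees on `(0, 1)` with convolution on the
line, where associativity is Fubini's theorem for integrable functions. -/
theorem convL_assoc (hσ : 0 ≤ σ) (u v w : WL2 σ) :
    convL σ (convL σ u v) w = convL σ u (convL σ v w) := by
  set U := (Ioo (0 : ℝ) 1).indicator u with hU
  set V := (Ioo (0 : ℝ) 1).indicator v with hV
  set W := (Ioo (0 : ℝ) 1).indicator w with hW
  have hU0 : ∀ t ≤ 0, U t = 0 := fun t => indicator_eq_zero_of_nonpos _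
  have hV0 : ∀ t ≤ 0, V t = 0 := fun t => indicator_eq_zero_of_nonpos _
  have hW0 : ∀ t ≤ 0, W t = 0 := fun t => indicator_eq_zero_of_nonpos _
  have hUi : Integrable U := (integrable_indicator_iff measurableSet_Ioo).2 (integrableOn_WL2 hσ u)
  have hVi : Integrable V := (integrable_indicator_iff measurableSet_Ioo).2 (integrableOn_WL2 hσ v)
  have hWi : Integrable W := (integrable_indicator_iff measurableSet_Ioo).2 (integrableOn_WL2 hσ w)
  have hmem : ∀ᵐ s ∂(weightMeasure σ), s ∈ Ioo (0 : ℝ) 1 :=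
    (ae_weightMeasure_iff σ).2 (ae_restrict_mem measurableSet_Ioo)
  have hassoc : ∀ᵐ s ∂(weightMeasure σ),
      ((U ⋆[ContinuousLinearMap.mul ℝ ℝ, volume] V) ⋆[ContinuousLinearMap.mul ℝ ℝ, volume] W) s =
      (U ⋆[ContinuousLinearMap.mul ℝ ℝ, volume] (V ⋆[ContinuousLinearMap.mul ℝ ℝ, volume] W)) s := by
    refine (ae_weightMeasure_iff σ).2 (ae_restrict_of_ae ?_)
    -- Fubini needs absolute convergence of the triple integral, available for almost every `s`.
    have h3 := hUi.norm.ae_convolution_exists (ContinuousLinearMap.mul ℝ ℝ)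
      (hVi.norm.integrable_convolution (ContinuousLinearMap.mul ℝ ℝ) hWi.norm)
    filter_upwards [h3] with s hs
    exact convolution_assoc _ _ _ _ (fun x y z => by simp [mul_assoc]) hUi.aestronglyMeasurable
      hVi.aestronglyMeasurable hWi.aestronglyMeasurable
      (hUi.ae_convolution_exists (ContinuousLinearMap.mul ℝ ℝ) hVi)
      (hVi.norm.ae_convolution_exists (ContinuousLinearMap.mul ℝ ℝ) hWi.norm) hs
  refine Lp.ext ?_
  filter_upwards [hassoc, hmem, convL_coeFn (convL σ u v) w, convL_coeFn u (convL σ v w)]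
    with s h hs h1 h2
  rw [convolution_eq_convFun (fun t => convolution_eq_zero hU0 hV0) hW0 hs.1.le,
    convolution_eq_convFun hU0 (fun t => convolution_eq_zero hV0 hW0) hs.1.le,
    convFun_congr (convL_ae_eq_convolution u v).symm (indicator_ae_eq w) hs,
    convFun_congr (indicator_ae_eq u) (convL_ae_eq_convolution v w).symm hs] at h
  rw [h1, h2]
  exact h

end Associativity

/-- Regularity of the solution of `F'(x₀) ω = x₀ - x₀(0)`: it has a square integrable weak
derivative. -/
theorem exists_hasWeakDeriv_of_volterra {σ : ℝ} (hσ : 0 ≤ σ) {a b : ℝ} (ha : a ≠ 0)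
    {x x₁ x₂ w : WL2 σ}
    (hx : x = Lp.const 2 (weightMeasure σ) a + convL σ (Lp.const 2 (weightMeasure σ) 1) x₁)
    (hx₁ : x₁ = Lp.const 2 (weightMeasure σ) b + convL σ (Lp.const 2 (weightMeasure σ) 1) x₂)
    (hw : autoconvDeriv x w = x - Lp.const 2 (weightMeasure σ) a) :
    ∃ w', HasWeakDeriv w w' := by
  set e : WL2 σ := Lp.const 2 (weightMeasure σ) 1 with he
  have hconst : ∀ r : ℝ, Lp.const 2 (weightMeasure σ) r = r • e := fun r => by
    have := map_smul (Lp.constₗ 2 (weightMeasure σ) ℝ) r (1 : ℝ)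
    simpa using this
  rw [hconst] at hx hx₁ hw
  -- The differentiated equation `2(a w + x' ⋆ w) = x'`: both sides of the Volterra equation are `1
  -- ⋆` something, and `1 ⋆` is injective.
  have h1 : (2 : ℝ) • (a • w + convL σ x₁ w) - x₁ = 0 := by
    refine convL_one_injective hσ ?_
    rw [← he]
    have h2 : autoconvDeriv x w = convL σ e ((2 : ℝ) • (a • w + convL σ x₁ w)) := by
      rw [autoconvDeriv, hx]
      simp only [smul_apply, map_add, map_smul, add_apply]
      rw [convL_assoc hσ]
    rw [map_sub, ← h2, hw, hx]
    abel
  have h3 : convL σ x₁ w = b • convL σ e w + convL σ e (convL σ x₂ w) := by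
    rw [hx₁]
    simp only [map_add, map_smul, add_apply, smul_apply]
    rw [convL_assoc hσ]
  have h4 : (2 * a) • w = x₁ - (2 : ℝ) • convL σ x₁ w := by
    rw [← sub_eq_zero, ← h1]
    module
  -- Solving for `w` and inserting `x' = b + 1 ⋆ x''` exhibits `w` as a constant plus the primitive
  -- of this witness.
  refine ⟨(2 * a)⁻¹ • (x₂ - (2 : ℝ) • (b • w + convL σ x₂ w)), ?_⟩
  have h5 : w = Lp.const 2 (weightMeasure σ) ((2 * a)⁻¹ * b) +
      convL σ e ((2 * a)⁻¹ • (x₂ - (2 : ℝ) • (b • w + convL σ x₂ w))) := by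
    have h6 : w = (2 * a)⁻¹ • ((2 * a) • w) := by
      rw [smul_smul, inv_mul_cancel₀ (by simpa using ha), one_smul]
    conv_lhs => rw [h6, h4, h3, hx₁]
    rw [hconst]
    simp only [map_add, map_smul, map_sub, mul_smul, smul_add, smul_sub]
    abel
  conv => arg 1; rw [h5]
  exact hasWeakDeriv_const_add hσ _ _

/-! ### Estimating `x₀(0)` from the noisy data. -/

theorem HasACDeriv.exists_bound {f g : ℝ → ℝ} (h : HasACDeriv f g) :
    ∃ M, 0 ≤ M ∧ ∀ t ∈ Icc (0 : ℝ) 1, |f t| ≤ M := by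
  obtain ⟨M, hM⟩ := isCompact_Icc.exists_bound_of_continuousOn h.continuousOn
  exact ⟨M, (abs_nonneg _).trans (hM 0 (left_mem_Icc.2 zero_le_one)), hM⟩

theorem HasACDeriv.abs_sub_le {f g : ℝ → ℝ} (h : HasACDeriv f g) {M : ℝ}
    (hM : ∀ t ∈ Icc (0 : ℝ) 1, |g t| ≤ M) {t : ℝ} (ht : t ∈ Icc (0 : ℝ) 1) :
    |f t - f 0| ≤ M * t := by
  rw [h.2 t ht, add_sub_cancel_left]
  have := intervalIntegral.norm_integral_le_of_norm_le_const (a := 0) (b := t) (f := g) (C := M)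
    (fun s hs => by
      rw [uIoc_of_le ht.1] at hs
      exact hM s ⟨hs.1.le, hs.2.trans ht.2⟩)
  rwa [sub_zero, abs_of_nonneg ht.1] at this

/-- On `[0, s]` the integrand `f(s - t) f(t)` is within `O(s)` of `f(0)²`, and the interval has
length `s`. -/
theorem abs_convFun_self_sub_le {f : ℝ → ℝ} (hf : ContinuousOn f (Icc 0 1)) {M : ℝ} (hM : 0 ≤ M)
    (hlip : ∀ t ∈ Icc (0 : ℝ) 1, |f t - f 0| ≤ M * t) {s : ℝ} (hs : s ∈ Icc (0 : ℝ) 1) :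
    |convFun f f s - f 0 ^ 2 * s| ≤ M * (2 * |f 0| + M) * s ^ 2 := by
  have hsub : ∀ t ∈ Icc 0 s, t ∈ Icc (0 : ℝ) 1 := fun t ht => ⟨ht.1, ht.2.trans hs.2⟩
  have hsub' : ∀ t ∈ Icc 0 s, s - t ∈ Icc (0 : ℝ) 1 := fun t ht =>
    ⟨by linarith [ht.2], by linarith [ht.1, hs.2]⟩
  have hint : IntervalIntegrable (fun t => f (s - t) * f t) volume 0 s := by
    refine ContinuousOn.intervalIntegrable ?_
    rw [uIcc_of_le hs.1]
    exact (hf.comp (by fun_prop) hsub').mul (hf.mono hsub)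
  have h1 : convFun f f s - f 0 ^ 2 * s =
      ∫ t in (0 : ℝ)..s, (f (s - t) * f t - f 0 ^ 2) := by
    rw [intervalIntegral.integral_sub hint intervalIntegrable_const, convFun]
    simp [mul_comm]
  rw [h1]
  have h2 := intervalIntegral.norm_integral_le_of_norm_le_const (a := 0) (b := s)
    (f := fun t => f (s - t) * f t - f 0 ^ 2) (C := M * (2 * |f 0| + M) * s) (fun t ht => by
      rw [uIoc_of_le hs.1] at ht
      have ht' : t ∈ Icc 0 s := Ioc_subset_Icc_self ht
      have a1 := hlip _ (hsub t ht')
      have a2 := hlip _ (hsub' t ht')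
      have a3 : |f t - f 0| ≤ M * s := a1.trans (by gcongr; exact ht.2)
      have a4 : |f (s - t) - f 0| ≤ M * s := a2.trans (by gcongr; linarith [ht.1])
      have a5 : |f t - f 0| ≤ M := a3.trans (mul_le_of_le_one_right hM hs.2)
      have a6 : |f t| ≤ |f 0| + M := by
        have := abs_sub_abs_le_abs_sub (f t) (f 0)
        linarith
      have e : f (s - t) * f t - f 0 ^ 2 =
          (f (s - t) - f 0) * f t + f 0 * (f t - f 0) := by ring
      have hMs : 0 ≤ M * s := mul_nonneg hM hs.1
      rw [Real.norm_eq_abs, e]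
      calc _ ≤ |f (s - t) - f 0| * |f t| + |f 0| * |f t - f 0| := by
            rw [← abs_mul, ← abs_mul]; exact abs_add_le _ _
        _ ≤ (M * s) * (|f 0| + M) + |f 0| * (M * s) := by gcongr
        _ = _ := by ring)
  rw [sub_zero, abs_of_nonneg hs.1] at h2
  refine h2.trans (le_of_eq ?_)
  ring

theorem abs_mean_sub_le {y : ℝ → ℝ} {l r c K : ℝ} (hlr : l < r)
    (hy : IntervalIntegrable y volume l r)
    (h : ∀ᵐ t, t ∈ Ioc l r → |y t - c| ≤ K) :
    |(r - l)⁻¹ * (∫ t in l..r, y t) - c| ≤ K := by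
  have hpos : 0 < r - l := sub_pos.2 hlr
  have h1 : (r - l)⁻¹ * (∫ t in l..r, y t) - c = (r - l)⁻¹ * ∫ t in l..r, (y t - c) := by
    rw [intervalIntegral.integral_sub hy intervalIntegrable_const]
    simp only [intervalIntegral.integral_const, smul_eq_mul]
    field_simp
  have h2 := intervalIntegral.norm_integral_le_of_norm_le_const_ae (a := l) (b := r)
    (f := fun t => y t - c) (C := K) (by
      rw [uIoc_of_le hlr.le]; exact h)
  rw [abs_of_pos hpos, Real.norm_eq_abs] at h2
  rw [h1, abs_mul, abs_of_pos (inv_pos.2 hpos), inv_mul_le_iff₀ hpos]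
  linarith

theorem abs_sqrt_sub_le {a b : ℝ} (hb : 0 < b) (ha : 0 ≤ a) :
    |√a - b| ≤ |a - b ^ 2| / b := by
  rw [le_div_iff₀ hb]
  have h : a - b ^ 2 = (√a - b) * (√a + b) := by
    nlinarith [Real.sq_sqrt ha]
  rw [h, abs_mul, abs_of_pos (add_pos_of_nonneg_of_pos (Real.sqrt_nonneg a) hb)]
  gcongr
  linarith [Real.sqrt_nonneg a]

/-- The cell of the uniform partition that contains `s ∈ [0, 1]`. -/
theorem cell_bounds {m : ℕ} (hm : 1 ≤ m) {s : ℝ} (hs : s ∈ Icc (0 : ℝ) 1) :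
    let i : ℕ := min ⌊m * s⌋₊ (m - 1)
    (i : ℝ) / m ≤ s ∧ s ≤ (i + 1) / m ∧ ((i : ℝ) + 1) / m ≤ 1 := by
  intro i
  have hm' : (0 : ℝ) < m := by exact_mod_cast hm
  have hi1 : i ≤ m - 1 := min_le_right _ _
  have hi1' : (i : ℝ) + 1 ≤ m := by
    have : i + 1 ≤ m := by omega
    exact_mod_cast this
  have hms : 0 ≤ m * s := mul_nonneg hm'.le hs.1
  refine ⟨?_, ?_, (div_le_one hm').2 hi1'⟩
  · rw [div_le_iff₀ hm', mul_comm]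
    exact (Nat.cast_le.2 (min_le_left _ _)).trans (Nat.floor_le hms)
  · rw [le_div_iff₀ hm', mul_comm s]
    rcases min_choice ⌊m * s⌋₊ (m - 1) with h | h
    · have : i = ⌊m * s⌋₊ := h
      rw [this]
      exact (Nat.lt_floor_add_one _).le
    · have h' : i = m - 1 := h
      have : (i : ℝ) + 1 = m := by
        have : i + 1 = m := by omega
        exact_mod_cast this
      rw [this]
      exact mul_le_of_le_one_right hm'.le hs.2

theorem abs_cellAverage_sub_le {m : ℕ} (hm : 1 ≤ m) {y : ℝ → ℝ} (hy : IntegrableOn y (Ioo 0 1))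
    {s c K : ℝ} (hs : s ∈ Icc (0 : ℝ) 1)
    (h : ∀ᵐ t ∂(volume.restrict (Ioo (0 : ℝ) 1)), |t - s| ≤ 1 / m → |y t - c| ≤ K) :
    |cellAverage m y s - c| ≤ K := by
  obtain ⟨h1, h2, h3⟩ := cell_bounds hm hs
  simp only [cellAverage]
  set i : ℕ := min ⌊m * s⌋₊ (m - 1)
  have hm' : (0 : ℝ) < m := by exact_mod_cast hm
  have h0 : (0 : ℝ) ≤ i / m := by positivity
  have hlen : ((i : ℝ) + 1) / m - i / m = 1 / m := by ring
  have hlr : (i : ℝ) / m < (i + 1) / m := by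
    rw [← sub_pos, hlen]; positivity
  have key := abs_mean_sub_le (y := y) (c := c) (K := K) hlr ?_ ?_
  · rwa [hlen, one_div, inv_inv] at key
  · rw [intervalIntegrable_iff_integrableOn_Ioo_of_le hlr.le]
    exact hy.mono_set (Ioo_subset_Ioo h0 h3)
  · have hne : ∀ᵐ t : ℝ, t ≠ 1 := by simp [ae_iff, measure_singleton]
    filter_upwards [(ae_restrict_iff' measurableSet_Ioo).1 h, hne] with t ht ht1 ht2
    refine ht ⟨h0.trans_lt ht2.1, lt_of_le_of_ne (ht2.2.trans h3) ht1⟩ ?_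
    rw [abs_le]
    constructor <;> linarith [ht2.1, ht2.2]

theorem abs_referenceValue_sub_le {m : ℕ} {δ a D : ℝ} {y : ℝ → ℝ} (hδ : 0 < δ) (ha : 0 < a)
    (h : |cellAverage m y (√δ) - a ^ 2 * √δ| ≤ D * δ) :
    |referenceValue m δ y - a| ≤ D / a * √δ := by
  have hs : 0 < √δ := Real.sqrt_pos.2 hδ
  set A := cellAverage m y (√δ) with hA
  have h1 : |1 / √δ * A - a ^ 2| ≤ D * √δ := by
    have e : 1 / √δ * A - a ^ 2 = (A - a ^ 2 * √δ) / √δ := by field_simp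
    rw [e, abs_div, abs_of_pos hs, div_le_iff₀ hs, mul_assoc, Real.mul_self_sqrt hδ.le]
    exact h
  rw [referenceValue, ← hA]
  split_ifs with h0
  · refine (abs_sqrt_sub_le ha (by positivity)).trans ?_
    rw [div_mul_eq_mul_div D]
    gcongr
  -- If the mean is negative, `a²` itself is at most `D√δ`, so the default value `0` is accurate
  -- enough.
  · rw [zero_sub, abs_neg, abs_of_pos ha, div_mul_eq_mul_div, le_div_iff₀ ha]
    have h2 : 1 / √δ * A ≤ 0 := mul_nonpos_of_nonneg_of_nonpos (by positivity) (not_le.1 h0).le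
    have h3 := (abs_le.1 h1).1
    nlinarith

theorem exists_referenceValue_bound {σ : ℝ} (hσ : 0 < σ) {x₀ : WL2 σ} {f g : ℝ → ℝ}
    (hf : x₀ =ᵐ[weightMeasure σ] f) (hac : HasACDeriv f g) {M : ℝ} (hM : 0 ≤ M)
    (hg : ∀ t ∈ Icc (0 : ℝ) 1, |g t| ≤ M) (hf0 : 0 < f 0) :
    ∃ D, 0 ≤ D ∧ ∀ δ : ℝ, 0 < δ → δ ≤ 1 → ∀ m : ℕ, σ / δ ≤ m → ∀ y : WL2 σ,
      (∀ᵐ t ∂(volume.restrict (Ioo (0 : ℝ) 1)), |y t - autoconv x₀ t| ≤ δ) →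
        |referenceValue m δ y - f 0| ≤ D * √δ := by
  set C := M * (2 * |f 0| + M) with hC
  have hC0 : 0 ≤ C := by positivity
  -- The three summands come from the noise, the remainder of `F(x₀)` at `0`, and the cell width
  -- `1/m ≤ δ/σ`; the divisor `f 0` comes from the square root.
  refine ⟨(1 + C * (1 + 1 / σ) ^ 2 + f 0 ^ 2 / σ) / f 0, by positivity, ?_⟩
  intro δ hδ hδ1 m hm y hy
  have hm0 : (0 : ℝ) < m := (div_pos hσ hδ).trans_le hm
  have hm1 : 1 ≤ m := by exact_mod_cast hm0
  have hinv : 1 / (m : ℝ) ≤ δ / σ := by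
    rw [div_le_div_iff₀ hm0 hσ, one_mul]
    rwa [div_le_iff₀ hδ, mul_comm] at hm
  have hs : √δ ∈ Icc (0 : ℝ) 1 := ⟨Real.sqrt_nonneg _, Real.sqrt_le_one.2 hδ1⟩
  refine abs_referenceValue_sub_le hδ hf0
    (abs_cellAverage_sub_le hm1 (integrableOn_WL2 hσ.le y) hs ?_)
  filter_upwards [hy, (ae_weightMeasure_iff σ).1 (convL_coeFn x₀ x₀),
    ae_restrict_mem measurableSet_Ioo] with t h1 h2 ht htm
  have h3 : autoconv x₀ t = convFun f f t := by
    rw [← convFun_congr hf hf ht]; exact h2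
  have h4 := abs_convFun_self_sub_le hac.continuousOn hM (fun t ht => hac.abs_sub_le hg ht)
    (Ioo_subset_Icc_self ht)
  rw [← hC] at h4
  rw [h3] at h1
  have h5 : |t - √δ| ≤ δ / σ := htm.trans hinv
  have h6 : t ≤ (1 + 1 / σ) * √δ := by
    have := (abs_le.1 h5).2
    -- Here `δ ≤ √δ`, by `δ ≤ 1`.
    have h7 : δ / σ ≤ 1 / σ * √δ := by
      rw [one_div_mul_eq_div]
      gcongr
      exact Real.le_sqrt_of_sq_le (by nlinarith)
    linarith
  have h7 : t ^ 2 ≤ (1 + 1 / σ) ^ 2 * δ := by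
    calc t ^ 2 ≤ ((1 + 1 / σ) * √δ) ^ 2 := pow_le_pow_left₀ ht.1.le h6 2
      _ = _ := by rw [mul_pow, Real.sq_sqrt hδ.le]
  calc |y t - f 0 ^ 2 * √δ|
      = |(y t - convFun f f t) + (convFun f f t - f 0 ^ 2 * t) + f 0 ^ 2 * (t - √δ)| := by
        congr 1; ring
    _ ≤ |y t - convFun f f t| + |convFun f f t - f 0 ^ 2 * t| + |f 0 ^ 2 * (t - √δ)| :=
        abs_add_three _ _ _
    _ ≤ δ + C * ((1 + 1 / σ) ^ 2 * δ) + f 0 ^ 2 * (δ / σ) := by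
        rw [abs_mul, abs_of_nonneg (sq_nonneg (f 0))]
        gcongr
        exact h4.trans (by gcongr)
    _ = _ := by ring

/-! ### Projection and noise errors, contraction, and choice of constants. -/

theorem ApproximationPower.norm_sub_starProjection_le {σ L : ℝ} {X : ℕ → Submodule ℝ (WL2 σ)}
    [∀ m, FiniteDimensional ℝ (X m)] (hX : ApproximationPower L X) {m : ℕ} (hm : 1 ≤ m)
    {x x' : WL2 σ} (hx : HasWeakDeriv x x') :
    ‖x - (X m).starProjection x‖ ≤ |L| * sobolevNorm x x' * (1 / m) := by
  rw [Submodule.starProjection_minimal]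
  refine ((hX m hm).2 x x' hx).trans ?_
  have h : 0 ≤ sobolevNorm x x' := by unfold sobolevNorm; positivity
  calc L / m * sobolevNorm x x' ≤ |L| / m * sobolevNorm x x' := by gcongr; exact le_abs_self L
    _ = _ := by ring

theorem norm_sub_le_of_ae {σ : ℝ} (hσ : 0 ≤ σ) {x y : WL2 σ} {δ : ℝ} (hδ : 0 ≤ δ)
    (h : ∀ᵐ t ∂(volume.restrict (Ioo (0 : ℝ) 1)), |y t - x t| ≤ δ) : ‖y - x‖ ≤ δ := by
  have h1 : ‖y - x‖ ≤ ‖Lp.const 2 (weightMeasure σ) δ‖ := by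
    refine Lp.norm_le_norm_of_ae_le ?_
    filter_upwards [(ae_weightMeasure_iff σ).2 h, Lp.coeFn_sub y x,
      Lp.coeFn_const (p := 2) (μ := weightMeasure σ) (c := δ)] with t h1 h2 h3
    rw [h2, h3]
    simpa [abs_of_nonneg hδ] using h1
  exact h1.trans ((norm_const_le hσ δ).trans_eq (abs_of_nonneg hδ))

/-- A self-map `G` of a ball in a finite-dimensional subspace with a quadratic remainder is a
contraction as soon as the radius is less than `α / 2`. -/
theorem exists_fixedPointMap_eq_self {σ α r : ℝ} {x₀ xs y p : WL2 σ} (K : Submodule ℝ (WL2 σ))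
    [FiniteDimensional ℝ K] (hα : 0 < α) (hacc : IsAccretive (autoconvDeriv x₀)) (hr : 2 * r < α)
    (hp : p ∈ Metric.closedBall x₀ r ∩ (K : Set (WL2 σ)))
    (hmaps : MapsTo (fixedPointMap α K.starProjection x₀ xs y)
      (Metric.closedBall x₀ r ∩ K) (Metric.closedBall x₀ r ∩ K)) :
    ∃ z ∈ Metric.closedBall x₀ r ∩ (K : Set (WL2 σ)),
      fixedPointMap α K.starProjection x₀ xs y z = z := by
  have hr0 : 0 ≤ r := Metric.nonempty_closedBall.1 ⟨p, hp.1⟩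
  have hcomplete : IsComplete (Metric.closedBall x₀ r ∩ (K : Set (WL2 σ))) :=
    (Metric.isClosed_closedBall.inter K.closed_of_finiteDimensional).isComplete
  have hc : ContractingWith (2 * r / α).toNNReal (hmaps.restrict _ _ _) := by
    refine ⟨?_, LipschitzWith.of_dist_le_mul fun u v => ?_⟩
    · rw [← NNReal.coe_lt_coe, Real.coe_toNNReal _ (by positivity), NNReal.coe_one, div_lt_one hα]
      exact hr
    · rw [Real.coe_toNNReal _ (by positivity), Subtype.dist_eq, Subtype.dist_eq, dist_eq_norm,
        dist_eq_norm]
      refine (norm_fixedPointMap_sub_le K hα hacc xs y u v).trans ?_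
      have hu := mem_closedBall_iff_norm.1 u.2.1
      have hv := mem_closedBall_iff_norm.1 v.2.1
      gcongr
      linarith
  obtain ⟨z, hz, hfix, -⟩ := hc.exists_fixedPoint' hcomplete hmaps hp (edist_ne_top _ _)
  exact ⟨z, hz, hfix⟩

/-- The contributions of the discretization error, the noise and the reference element are at most
`ε * α` if `α` is a sufficiently large multiple of `√δ`. -/
theorem perturbation_bound {n P D ε s α : ℝ} (hn : 0 ≤ n) (hP : 0 ≤ P) (hD : 0 ≤ D) (hε : 0 < ε)
    (hs : 0 < s) (hs1 : s ≤ 1)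
    (hα : (1 + (2 * (2 * n * P) + 1 + D + P) / ε) * s ≤ α) :
    2 * n * (P * s ^ 2) + s ^ 2 + α * (D * s) + α * (P * s ^ 2) +
      α * (2 * n * (P * s ^ 2)) ≤ ε * α ^ 2 ∧ P * s ^ 2 ≤ ε * α := by
  set k := 2 * n * P with hk
  have hk0 : 0 ≤ k := by positivity
  set K := 2 * k + 1 + D + P with hK
  have hK0 : 0 ≤ K := by positivity
  -- The summand `1` in the constant serves this bound, which trades `s²` for `αs`.
  have h1 : s ≤ α := by
    have : 0 ≤ K / ε * s := by positivity
    linarith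
  have h2 : K * s ≤ ε * α := by
    have h3 : K / ε * s ≤ α := by linarith
    have h4 : ε * (K / ε * s) ≤ ε * α := by gcongr
    have h5 : ε * (K / ε * s) = K * s := by field_simp
    linarith
  have hα0 : 0 < α := hs.trans_le h1
  have hss : s ^ 2 ≤ s := by nlinarith
  refine ⟨?_, ?_⟩
  · have a1 : (k + 1) * s ^ 2 ≤ (k + 1) * (α * s) := by
      gcongr; nlinarith
    have a2 : α * ((P + k) * s ^ 2) ≤ α * ((P + k) * s) := by gcongr
    calc _ = (k + 1) * s ^ 2 + α * (D * s) + α * ((P + k) * s ^ 2) := by rw [hk]; ring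
      _ ≤ (k + 1) * (α * s) + α * (D * s) + α * ((P + k) * s) := by linarith
      _ = α * (K * s) := by rw [hK]; ring
      _ ≤ α * (ε * α) := by gcongr
      _ = _ := by ring
  · calc P * s ^ 2 ≤ P * s := by gcongr
      _ ≤ K * s := by gcongr; linarith
      _ ≤ _ := h2

theorem mainTheorem4 (σ L : ℝ) (hσ : 0 < σ)
    -- the exact solution, with its continuous representative `f`
    (x₀ : WL2 σ) (f : ℝ → ℝ) (hf : x₀ =ᵐ[weightMeasure σ] f) (hW : MemW2Infty f)
    (hpos : ∀ t ∈ Ico (0 : ℝ) 1, 0 < f t)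
    (hacc : IsAccretive (autoconvDeriv x₀))
    -- the solution of the linear Volterra equation
    (ω : WL2 σ) (hω : autoconvDeriv x₀ ω = x₀ - Lp.const 2 (weightMeasure σ) (f 0))
    (hω_small : ‖ω‖ < 1 / 4) :
    ∃ c : ℝ, 0 < c ∧
      ∀ (X : ℕ → Submodule ℝ (WL2 σ)) [∀ m, FiniteDimensional ℝ (X m)],
        ApproximationPower L X →
      ∀ (δ : ℝ), 0 < δ → δ ≤ 1 → ∀ (m : ℕ), σ / δ ≤ m →
      ∀ (y : WL2 σ),
        (∀ᵐ t ∂(volume.restrict (Ioo (0 : ℝ) 1)), |y t - autoconv x₀ t| ≤ δ) →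
      ∀ (α : ℝ), c * √δ ≤ α →
        let Q : WL2 σ →L[ℝ] WL2 σ := (X m).starProjection
        let xs : WL2 σ := referenceElement m δ y
        let G : WL2 σ → WL2 σ := fixedPointMap α Q x₀ xs y
        (regOp α Q x₀).IsInvertible ∧
        (∀ z ∈ X m, G z = z ↔ α • Q (xs - z) + Q y = Q (autoconv (Q z))) ∧
        ∃ r : ℝ, 0 < r ∧
          MapsTo G (Metric.closedBall x₀ r ∩ X m) (Metric.closedBall x₀ r ∩ X m) ∧
          ∃ z ∈ Metric.closedBall x₀ r ∩ X m, G z = z := by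
  obtain ⟨f₁, f₂, hf₁, hf₂, hmem⟩ := hW
  have hf0 : 0 < f 0 := hpos 0 ⟨le_rfl, one_pos⟩
  obtain ⟨M, hM0, hM⟩ := hf₂.exists_bound
  obtain ⟨D, hD0, hD⟩ := exists_referenceValue_bound hσ hf hf₁ hM0 hM hf0
  have hmem₂ : MemLp f₂ 2 (weightMeasure σ) :=
    (hmem.mono_measure (weightMeasure_le_restrict hσ.le)).mono_exponent le_top
  have hmem₁ : MemLp f₁ 2 (weightMeasure σ) := by
    refine MemLp.of_bound ?_ M ?_
    · refine AEStronglyMeasurable.mono_measure ?_ (weightMeasure_le_restrict hσ.le)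
      exact (hf₂.continuousOn.mono Ioo_subset_Icc_self).aestronglyMeasurable measurableSet_Ioo
    · refine (ae_weightMeasure_iff σ).2 ?_
      filter_upwards [ae_restrict_mem measurableSet_Ioo] with t ht
      exact hM t (Ioo_subset_Icc_self ht)
  have hx := hf₁.eq_const_add hf hmem₁.coeFn_toLp
  have hx₁ := hf₂.eq_const_add hmem₁.coeFn_toLp hmem₂.coeFn_toLp
  have hx' : HasWeakDeriv x₀ (hmem₁.toLp f₁) := by
    have := hasWeakDeriv_const_add hσ.le (f 0) (hmem₁.toLp f₁)
    rwa [← hx] at this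
  obtain ⟨ω', hω'⟩ := exists_hasWeakDeriv_of_volterra hσ.le hf0.ne' hx hx₁ hω
  set P : ℝ := |L| * (sobolevNorm x₀ (hmem₁.toLp f₁) + sobolevNorm ω ω') / σ with hP
  have hsob : ∀ u v : WL2 σ, 0 ≤ sobolevNorm u v := fun u v => by unfold sobolevNorm; positivity
  have hP0 : 0 ≤ P := by
    have := hsob x₀ (hmem₁.toLp f₁)
    have := hsob ω ω'
    positivity
  -- `η` is the slack in `‖ω‖ < 1/4`. With `ρ = 1/2 - η`, `ρ² + ‖ω‖ = ρ - η + η²`, which leaves room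
  -- for `ε = η/2` since `η ≤ 1/2`.
  set η : ℝ := 1 / 4 - ‖ω‖ with hη
  have hη0 : 0 < η := by linarith
  have hη1 : η ≤ 1 / 4 := by linarith [norm_nonneg ω]
  set ρ : ℝ := 1 / 2 - η with hρ
  set ε : ℝ := η / 2 with hε
  have hρε : ρ ^ 2 + ε + ‖ω‖ ≤ ρ := by
    have : ‖ω‖ = 1 / 4 - η := by linarith
    rw [this, hρ, hε]
    nlinarith
  refine ⟨1 + (2 * (2 * ‖x₀‖ * P) + 1 + D + P) / ε, by positivity, ?_⟩
  intro X _ hX δ hδ hδ1 m hm y hy α hcα Q xs G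
  have hs : 0 < √δ := Real.sqrt_pos.2 hδ
  have hsq : √δ ^ 2 = δ := Real.sq_sqrt hδ.le
  have hα : 0 < α := lt_of_lt_of_le (by positivity) hcα
  have hm0 : (0 : ℝ) < m := (div_pos hσ hδ).trans_le hm
  have hm1 : 1 ≤ m := by exact_mod_cast hm0
  have hinv : 1 / (m : ℝ) ≤ δ / σ := by
    rw [div_le_div_iff₀ hm0 hσ, one_mul]
    rwa [div_le_iff₀ hδ, mul_comm] at hm
  have happrox : ∀ u u' : WL2 σ, HasWeakDeriv u u' →
      sobolevNorm u u' ≤ sobolevNorm x₀ (hmem₁.toLp f₁) + sobolevNorm ω ω' →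
      ‖u - Q u‖ ≤ P * √δ ^ 2 := fun u u' hu hle => by
    refine (hX.norm_sub_starProjection_le hm1 hu).trans ?_
    rw [hsq, hP, div_mul_eq_mul_div, mul_div_assoc]
    have := mul_nonneg (abs_nonneg L) ((hsob u u').trans hle)
    gcongr
  have hp := happrox x₀ _ hx' (by linarith [hsob ω ω'])
  have hq := happrox ω _ hω' (by linarith [hsob x₀ (hmem₁.toLp f₁)])
  have hnoise : ‖y - autoconv x₀‖ ≤ √δ ^ 2 :=
    (norm_sub_le_of_ae hσ.le hδ.le hy).trans_eq hsq.symm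
  have href : ‖Lp.const 2 (weightMeasure σ) (referenceValue m δ y - f 0)‖ ≤ D * √δ :=
    (norm_const_le hσ.le _).trans (hD δ hδ hδ1 m hm y hy)
  obtain ⟨hb1, hb2⟩ := perturbation_bound (norm_nonneg x₀) hP0 hD0 (half_pos hη0) hs
    (Real.sqrt_le_one.2 hδ1) hcα
  rw [← hε] at hb1 hb2
  have hmaps : MapsTo G (Metric.closedBall x₀ (ρ * α) ∩ X m)
      (Metric.closedBall x₀ (ρ * α) ∩ X m) := by
    rintro z ⟨hz, -⟩
    refine ⟨?_, fixedPointMap_mem (X m) hα hacc xs y z⟩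
    rw [mem_closedBall_iff_norm] at hz ⊢
    refine (norm_fixedPointMap_sub_center_le (X m) hα hacc hω y z).trans ?_
    have hz2 : ‖z - x₀‖ ^ 2 ≤ (ρ * α) ^ 2 := pow_le_pow_left₀ (norm_nonneg _) hz 2
    have h1 : 2 * ‖x₀‖ * ‖x₀ - Q x₀‖ + ‖y - autoconv x₀‖ + ‖z - x₀‖ ^ 2
        + α * ‖Lp.const 2 (weightMeasure σ) (referenceValue m δ y - f 0)‖ + α * ‖x₀ - Q x₀‖
        + α * (2 * ‖x₀‖ * ‖ω - Q ω‖) ≤ 2 * ‖x₀‖ * (P * √δ ^ 2) + √δ ^ 2 + (ρ * α) ^ 2 +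
        α * (D * √δ) + α * (P * √δ ^ 2) + α * (2 * ‖x₀‖ * (P * √δ ^ 2)) := by
      gcongr
    have h2 : (2 * ‖x₀‖ * ‖x₀ - Q x₀‖ + ‖y - autoconv x₀‖ + ‖z - x₀‖ ^ 2
        + α * ‖Lp.const 2 (weightMeasure σ) (referenceValue m δ y - f 0)‖ + α * ‖x₀ - Q x₀‖
        + α * (2 * ‖x₀‖ * ‖ω - Q ω‖)) / α ≤ (ρ ^ 2 + ε) * α := by
      rw [div_le_iff₀ hα]
      linarith
    calc _ ≤ (ρ ^ 2 + ε) * α + α * ‖ω‖ := by gcongr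
      _ = (ρ ^ 2 + ε + ‖ω‖) * α := by ring
      _ ≤ ρ * α := by gcongr
  refine ⟨isInvertible_regOp (X m) hα hacc,
    fun z hz => fixedPointMap_eq_self_iff (X m) hα hacc xs y hz, ρ * α,
    mul_pos (by linarith) hα, hmaps, ?_⟩
  -- The iteration may start at `Q x₀`, which lies in the ball: `‖x₀ - Q x₀‖ ≤ εα ≤ ρα`, as `ε ≤
  -- 1/8` and `ρ ≥ 1/4`.
  refine exists_fixedPointMap_eq_self (p := Q x₀) (X m) hα hacc (by nlinarith) ?_ hmaps
  refine ⟨?_, Submodule.starProjection_apply_mem _ _⟩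
  rw [mem_closedBall_iff_norm, norm_sub_rev]
  refine (hp.trans hb2).trans ?_
  gcongr
  linarith
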